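/- **Theorem (perfect discrimination for manifolds).** Let $\mathcal M,\mathcal P\subseteq\mathbb R^d$ be closed subsets that are regular (smoothly embedded) submanifolds of $\mathbb R^d$, with or without boundary, of dimensions $m\neq d$ and $p\neq d$ respectively. Two submanifolds $S,T$ without boundary are said to *perfectly align* if there is a point $x\in S\cap T$ with $T_xS+T_xT\neq\mathbb R^d$; two submanifolds $\mathcal M,\mathcal P$ with or without boundary *perfectly align* if at least one of the pairs $(\operatorname{Int}\mathcal M,\operatorname{Int}\mathcal P)$, $(\operatorname{Int}\mathcal M,\partial\mathcal P)$, $(\partial\mathcal M,\operatorname{Int}\mathcal P)$, $(\partial\mathcal M,\partial\mathcal P)$ does. Suppose that $\mathcal M$ and $\mathcal P$ do not perfectly align. Let $\mathbb P_r$ and $\mathbb P_g$ be Borel probability measures on $\mathbb R^d$ whose supports are contained in $\mathcal M$ and $\mathcal P$ respectively, and suppose that each is absolutely continuous with respect to its manifold: if $A$ has measure $0$ in $\mathcal M$ (that is, $A\cap\mathcal M$ has $m$-dimensional volume $0$), then $\mathbb P_r(A)=0$, and if $A$ has measure $0$ in $\mathcal P$ (that is, $A\cap\mathcal P$ has $p$-dimensional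 volume $0$), then $\mathbb P_g(A)=0$. Then there is a measurable function $D^*:\mathbb R^d\to[0,1]$ such that 1. $D^*$ is an optimal discriminator: it maximizes $$L(D)=\mathbb E_{x\sim\mathbb P_r}[\log D(x)]+\mathbb E_{x\sim\mathbb P_g}[\log(1-D(x))]\in[-\infty,0]$$ over all measurable $D:\mathbb R^d\to[0,1]$ (with $\log 0=-\infty$); 2. $D^*$ has accuracy $1$: $\mathbb P_r(\{x: D^*(x)=1\})=1$ and $\mathbb P_g(\{x: D^*(x)=0\})=1$; 3. for almost every $x\in\mathcal M$ (with respect to $m$-dimensional volume on $\mathcal M$) and for almost every $x\in\mathcal P$ (with respect to $p$-dimensional volume on $\mathcal P$), $D^*$ is $C^\infty$ in a neighbourhood of $x$ and $\nabla D^*(x)=0$. -/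

import Mathlib

open MeasureTheory Set Topology
open scoped ContDiff ENNReal

namespace GANPerfect

/-- The ambient space `ℝ^d` with its Euclidean norm. -/
abbrev Space (d : ℕ) : Type := EuclideanSpace ℝ (Fin d)

/-! ### Regular submanifolds of `ℝ^d`, with or without boundary -/

/-- The `m`-dimensional coordinate plane `ℝ^m × {0}` in `ℝ^d`. -/
def slice (d m : ℕ) : Set (Space d) :=
  {y | ∀ i : Fin d, m ≤ (i : ℕ) → y i = 0}

/-- The half-plane of `ℝ^m × {0}` on which the `m`-th (last) coordinate is nonnegative. It is used
only through `HasBoundaryChartAt`, which forces `1 ≤ m`. -/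
def halfSlice (d m : ℕ) : Set (Space d) :=
  {y | y ∈ slice d m ∧ ∀ i : Fin d, (i : ℕ) + 1 = m → 0 ≤ y i}

/-- `Φ` is a `C^∞` diffeomorphism between open subsets of `ℝ^d`, its source contains `x`, and it
maps the part of `M` in its source onto the part of `S` in its target. -/
structure IsFlatteningAt {d : ℕ} (Φ : OpenPartialHomeomorph (Space d) (Space d))
    (M S : Set (Space d)) (x : Space d) : Prop where
  mem_source : x ∈ Φ.source
  contDiffOn : ContDiffOn ℝ ∞ Φ Φ.source
  contDiffOn_symm : ContDiffOn ℝ ∞ Φ.symm Φ.target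
  mem_iff : ∀ y ∈ Φ.source, y ∈ M ↔ Φ y ∈ S

/-- Near `x`, the set `M` is a smooth `m`-dimensional submanifold without boundary. -/
def HasInteriorChartAt {d : ℕ} (m : ℕ) (M : Set (Space d)) (x : Space d) : Prop :=
  ∃ Φ : OpenPartialHomeomorph (Space d) (Space d), IsFlatteningAt Φ M (slice d m) x

/-- Near `x`, the set `M` is a smooth `m`-dimensional half-space, with `x` on its boundary. -/
def HasBoundaryChartAt {d : ℕ} (m : ℕ) (M : Set (Space d)) (x : Space d) : Prop :=
  ∃ Φ : OpenPartialHomeomorph (Space d) (Space d), IsFlatteningAt Φ M (halfSlice d m) x ∧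
    ∃ i : Fin d, (i : ℕ) + 1 = m ∧ Φ x i = 0

/-- The manifold interior `Int M`. -/
def manifoldInterior {d : ℕ} (m : ℕ) (M : Set (Space d)) : Set (Space d) :=
  {x | x ∈ M ∧ HasInteriorChartAt m M x}

/-- The manifold boundary `∂M`. -/
def manifoldBoundary {d : ℕ} (m : ℕ) (M : Set (Space d)) : Set (Space d) :=
  {x | x ∈ M ∧ HasBoundaryChartAt m M x}

/-- `M` is a regular (that is, smoothly embedded) `m`-dimensional submanifold of `ℝ^d`, with or
without boundary. -/
structure IsRegularSubmanifold {d : ℕ} (m : ℕ) (M : Set (Space d)) : Prop where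
  dim_le : m ≤ d
  exists_chart : ∀ x ∈ M, x ∈ manifoldInterior m M ∨ x ∈ manifoldBoundary m M

/-! ### Transversality and perfect alignment -/

/-- The tangent space `T_x S`, spanned by the velocities at `x` of the smooth curves in `S` through
`x`. (If `S` is a regular submanifold without boundary, these velocities already form a linear
subspace, so that taking the span adds nothing.) -/
def tangentSpaceAt {d : ℕ} (S : Set (Space d)) (x : Space d) : Submodule ℝ (Space d) :=
  Submodule.span ℝ {v | ∃ γ : ℝ → Space d, ContDiffAt ℝ ∞ γ 0 ∧ γ 0 = x ∧
    (∀ᶠ t in 𝓝 (0 : ℝ), γ t ∈ S) ∧ deriv γ 0 = v}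

/-- `S` and `T` intersect transversally in `x`: `T_x S + T_x T = ℝ^d`. -/
def TransversalAt {d : ℕ} (S T : Set (Space d)) (x : Space d) : Prop :=
  tangentSpaceAt S x ⊔ tangentSpaceAt T x = ⊤

/-- Perfect alignment of two submanifolds without boundary. -/
def PerfectlyAlignBoundaryless {d : ℕ} (S T : Set (Space d)) : Prop :=
  ∃ x ∈ S ∩ T, ¬ TransversalAt S T x

/-- Perfect alignment of two submanifolds, of dimensions `m` and `p`, with or without boundary. -/
def PerfectlyAlign {d : ℕ} (m p : ℕ) (M P : Set (Space d)) : Prop :=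
  PerfectlyAlignBoundaryless (manifoldInterior m M) (manifoldInterior p P) ∨
  PerfectlyAlignBoundaryless (manifoldInterior m M) (manifoldBoundary p P) ∨
  PerfectlyAlignBoundaryless (manifoldBoundary m M) (manifoldInterior p P) ∨
  PerfectlyAlignBoundaryless (manifoldBoundary m M) (manifoldBoundary p P)

/-- The `m`-dimensional volume measure of an `m`-dimensional submanifold `M` of `ℝ^d`, namely the
`m`-dimensional Hausdorff measure on `M` (up to a constant factor, the Riemannian volume). Its null
sets are the sets that have Lebesgue measure zero in every chart of `M`. -/
noncomputable def manifoldMeasure {d : ℕ} (m : ℕ) (M : Set (Space d)) : Measure (Space d) :=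
  (Measure.hausdorffMeasure (m : ℝ)).restrict M

/-! ### Discriminators -/

/-- A discriminator: a measurable function `ℝ^d → [0, 1]`. -/
def IsDiscriminator {d : ℕ} (D : Space d → ℝ) : Prop :=
  Measurable D ∧ ∀ x, D x ∈ Icc (0 : ℝ) 1

/-- `-log t ∈ [0, ∞]` for `t ∈ [0, 1]`, with `-log 0 = ∞`. -/
noncomputable def negLog (t : ℝ) : ℝ≥0∞ :=
  (-(ENNReal.log (ENNReal.ofReal t))).toENNReal

/-- The objective `L(D) = E_{x ∼ Pr} [log D(x)] + E_{x ∼ Pg} [log (1 - D(x))] ∈ [-∞, 0]` of a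
discriminator `D`; both expectations are integrals of functions with values in `[-∞, 0]`. -/
noncomputable def ganObjective {d : ℕ} (Pr Pg : Measure (Space d)) (D : Space d → ℝ) : EReal :=
  -((∫⁻ x, negLog (D x) ∂Pr : ℝ≥0∞) : EReal) + -((∫⁻ x, negLog (1 - D x) ∂Pg : ℝ≥0∞) : EReal)

/-- `D` is an optimal discriminator. -/
def IsOptimalDiscriminator {d : ℕ} (Pr Pg : Measure (Space d)) (D : Space d → ℝ) : Prop :=
  IsDiscriminator D ∧
    ∀ D' : Space d → ℝ, IsDiscriminator D' → ganObjective Pr Pg D' ≤ ganObjective Pr Pg D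

/-- `D` has accuracy 1. -/
def HasAccuracyOne {d : ℕ} (Pr Pg : Measure (Space d)) (D : Space d → ℝ) : Prop :=
  Pr {x | D x = 1} = 1 ∧ Pg {x | D x = 0} = 1

/-- `D` is smooth in a neighbourhood of `x`, and its gradient at `x` is zero. -/
def SmoothNearWithZeroGradient {d : ℕ} (D : Space d → ℝ) (x : Space d) : Prop :=
  (∃ U : Set (Space d), IsOpen U ∧ x ∈ U ∧ ContDiffOn ℝ ∞ D U) ∧ HasGradientAt D 0 x

end GANPerfect

/-!
Write `K = M ∩ P`. The discriminator is the indicator of the open set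
`{x | dist (x, M) < dist (x, P)}`. Since `M` and `P` are closed, this function is constantly `1` near
every point of `M \ P` and constantly `0` near every point of `P \ M`, so everything reduces to
showing that `K` is null for the volume of `M` (and, by symmetry, for that of `P`). Given this,
`Pr`-almost every point lies in `M \ P` and `Pg`-almost every point in `P \ M`, so both expectations
in the objective vanish, and `0` is its largest possible value.

That `K` is null is a local statement (`exists_nhds_dimH_inter_lt`). Near `x ∈ K`, in charts
`Φ` of `M` and `Ψ` of `P`, every point of `M` satisfies `Φ ∈ ℝ^m × {0}`, and every point of `P`
satisfies `Ψ_p = 0`, a coordinate that exists because `p < d`; this holds in interior and in boundary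
charts alike. Velocities of curves in `P` are killed by `dΨ_p`, which is not zero, so transversality
provides a curve in `M` with velocity `v` such that `dΨ_p v ≠ 0`. Put `w = dΦ v ∈ ℝ^m × {0}` and
let `ℓ` be a linear form with `ℓ w = 1`. The map `y ↦ (Φ y - ℓ (Φ y) w, Ψ_p y)` has injective
derivative at `x`, hence is antilipschitz near `x`, and maps `K` into `((ℝ^m × {0}) ∩ ker ℓ) × {0}`,
a space of dimension less than `m`. So `K` has Hausdorff dimension less than `m` near `x`.
-/

namespace GANPerfect

/-! ### Hausdorff dimension and maps with injective derivative -/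

theorem dimH_submodule {E : Type*} [NormedAddCommGroup E] [NormedSpace ℝ E]
    [FiniteDimensional ℝ E] (L : Submodule ℝ E) :
    dimH (L : Set E) = Module.finrank ℝ L := by
  have h := (isometry_subtype_coe (s := (L : Set E))).dimH_image univ
  rw [image_univ, Subtype.range_coe] at h
  rw [h]
  exact Real.dimH_univ_eq_finrank L

/-- A map whose strict derivative at `x` is injective cannot lower the Hausdorff dimension near
`x`. -/
theorem exists_nhds_dimH_le {E F : Type*} [NormedAddCommGroup E] [NormedSpace ℝ E]
    [FiniteDimensional ℝ E] [NormedAddCommGroup F] [NormedSpace ℝ F]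
    {f : E → F} {f' : E →L[ℝ] F} {x : E} (hf : HasStrictFDerivAt f f' x)
    (hinj : Function.Injective f') :
    ∃ V ∈ 𝓝 x, ∀ (K : Set E) (L : Set F), (∀ y ∈ K ∩ V, f y ∈ L) →
      dimH (K ∩ V) ≤ dimH L := by
  obtain ⟨c, hc0, hc⟩ := f'.exists_antilipschitzWith (LinearMap.ker_eq_bot.2 hinj)
  have hc' : 0 < c⁻¹ := inv_pos.2 hc0
  obtain ⟨V, hV, happ⟩ := hf.approximates_deriv_on_nhds (c := c⁻¹ / 2) (Or.inr (half_pos hc'))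
  refine ⟨V, hV, fun K L hKL => ?_⟩
  have hanti : AntilipschitzWith (c⁻¹ - c⁻¹ / 2)⁻¹ (V.domRestrict f) := by
    have h1 : LipschitzWith (c⁻¹ / 2) (V.domRestrict f - V.domRestrict f') :=
      happ.lipschitz_sub
    have h2 : AntilipschitzWith c (V.domRestrict f') := hc.domRestrict V
    have h3 : V.domRestrict f =
        fun y => V.domRestrict f' y + (V.domRestrict f - V.domRestrict f') y := by
      funext y
      simp
    rw [h3]
    exact h2.add_lipschitzWith h1 (NNReal.half_lt_self hc'.ne')
  have hsub : K ∩ V ⊆ Subtype.val '' (V.domRestrict f ⁻¹' L) := fun y hy =>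
    ⟨⟨y, hy.2⟩, hKL y hy, rfl⟩
  calc dimH (K ∩ V) ≤ dimH (Subtype.val '' (V.domRestrict f ⁻¹' L)) := dimH_mono hsub
    _ = dimH (V.domRestrict f ⁻¹' L) := isometry_subtype_coe.dimH_image _
    _ ≤ dimH L := hanti.dimH_preimage_le L

/-! ### Coordinate planes, charts and tangent vectors -/

/-- The coordinate plane `slice d m` as a linear subspace. -/
def sliceSubmodule (d m : ℕ) : Submodule ℝ (Space d) where
  carrier := slice d m
  zero_mem' := fun _ _ => rfl
  add_mem' := fun {a b} ha hb i hi => by simp [ha i hi, hb i hi]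
  smul_mem' := fun c a ha i hi => by simp [ha i hi]

theorem finrank_sliceSubmodule_le {d m : ℕ} (h : m ≤ d) :
    Module.finrank ℝ (sliceSubmodule d m) ≤ m := by
  let f : sliceSubmodule d m →ₗ[ℝ] (Fin m → ℝ) :=
    { toFun := fun y i => (y : Space d) (Fin.castLE h i)
      map_add' := fun _ _ => rfl
      map_smul' := fun _ _ => rfl }
  have hf : Function.Injective f := by
    intro a b hab
    ext i
    by_cases hi : m ≤ (i : ℕ)
    · rw [a.2 i hi, b.2 i hi]
    · exact congrFun hab ⟨i, not_le.1 hi⟩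
  simpa using LinearMap.finrank_le_finrank_of_injective hf

/-- Interior and boundary charts alike map the submanifold into the coordinate plane. -/
theorem IsRegularSubmanifold.exists_chart_mem_slice {d m : ℕ} {M : Set (Space d)}
    (hM : IsRegularSubmanifold m M) {x : Space d} (hx : x ∈ M) :
    ∃ Φ : OpenPartialHomeomorph (Space d) (Space d), x ∈ Φ.source ∧
      ContDiffOn ℝ ∞ Φ Φ.source ∧ ContDiffOn ℝ ∞ Φ.symm Φ.target ∧
      ∀ y ∈ Φ.source, y ∈ M → Φ y ∈ slice d m := by
  rcases hM.exists_chart x hx with ⟨-, Φ, h⟩ | ⟨-, Φ, h, -⟩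
  · exact ⟨Φ, h.mem_source, h.contDiffOn, h.contDiffOn_symm, fun y hy => (h.mem_iff y hy).1⟩
  · exact ⟨Φ, h.mem_source, h.contDiffOn, h.contDiffOn_symm,
      fun y hy hyM => ((h.mem_iff y hy).1 hyM).1⟩

theorem injective_fderiv_chart {d : ℕ} {Φ : OpenPartialHomeomorph (Space d) (Space d)}
    {x : Space d} (hx : x ∈ Φ.source) (h : ContDiffOn ℝ ∞ Φ Φ.source)
    (hs : ContDiffOn ℝ ∞ Φ.symm Φ.target) : Function.Injective (fderiv ℝ Φ x) := by
  have h1 : HasFDerivAt Φ (fderiv ℝ Φ x) x :=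
    ((h.contDiffAt (Φ.open_source.mem_nhds hx)).differentiableAt (by simp)).hasFDerivAt
  have h2 : HasFDerivAt Φ.symm (fderiv ℝ Φ.symm (Φ x)) (Φ x) :=
    ((hs.contDiffAt (Φ.open_target.mem_nhds (Φ.map_source hx))).differentiableAt
      (by simp)).hasFDerivAt
  have h3 : HasFDerivAt (Φ.symm ∘ Φ) (ContinuousLinearMap.id ℝ (Space d)) x :=
    (hasFDerivAt_id x).congr_of_eventuallyEq (Φ.eventually_left_inverse hx)
  have h4 := (h2.comp x h1).unique h3
  exact Function.LeftInverse.injective (g := fderiv ℝ Φ.symm (Φ x)) fun u =>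
    DFunLike.congr_fun h4 u

/-- A linear condition satisfied by a map along a curve is satisfied by the derivative of the map
at the velocity of the curve. -/
theorem clm_apply_velocity_eq_zero {E F : Type*} [NormedAddCommGroup E] [NormedSpace ℝ E]
    [NormedAddCommGroup F] [NormedSpace ℝ F] {f : E → F} {f' : E →L[ℝ] F} {γ : ℝ → E} {x : E}
    (hf : HasFDerivAt f f' x) (hγ : DifferentiableAt ℝ γ 0) (h0 : γ 0 = x)
    (ℓ : F →L[ℝ] ℝ) (h : ∀ᶠ t in 𝓝 (0 : ℝ), ℓ (f (γ t)) = 0) : ℓ (f' (deriv γ 0)) = 0 := by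
  subst h0
  have h1 : HasDerivAt (fun t => ℓ (f (γ t))) (ℓ (f' (deriv γ 0))) 0 :=
    ℓ.hasFDerivAt.comp_hasDerivAt 0 (hf.comp_hasDerivAt 0 hγ.hasDerivAt)
  exact h1.unique ((hasDerivAt_const (0 : ℝ) (0 : ℝ)).congr_of_eventuallyEq h)

/-- At a common point, some pair of strata intersects transversally; only the inclusions of the
strata in `M` and `P` matter. -/
theorem exists_transversalAt {d m p : ℕ} {M P : Set (Space d)}
    (hM : IsRegularSubmanifold m M) (hP : IsRegularSubmanifold p P)
    (halign : ¬ PerfectlyAlign m p M P) {x : Space d} (hx : x ∈ M ∩ P) :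
    ∃ S T : Set (Space d), S ⊆ M ∧ T ⊆ P ∧ TransversalAt S T x := by
  simp only [PerfectlyAlign, PerfectlyAlignBoundaryless, not_or, not_exists, not_and,
    not_not] at halign
  obtain ⟨h1, h2, h3, h4⟩ := halign
  rcases hM.exists_chart x hx.1 with hm | hm <;> rcases hP.exists_chart x hx.2 with hp | hp
  · exact ⟨_, _, fun y hy => hy.1, fun y hy => hy.1, h1 x ⟨hm, hp⟩⟩
  · exact ⟨_, _, fun y hy => hy.1, fun y hy => hy.1, h2 x ⟨hm, hp⟩⟩
  · exact ⟨_, _, fun y hy => hy.1, fun y hy => hy.1, h3 x ⟨hm, hp⟩⟩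
  · exact ⟨_, _, fun y hy => hy.1, fun y hy => hy.1, h4 x ⟨hm, hp⟩⟩

/-! ### The intersection is null -/

theorem exists_nhds_dimH_inter_lt {d m p : ℕ} {M P : Set (Space d)}
    (hM : IsRegularSubmanifold m M) (hP : IsRegularSubmanifold p P) (hp : p ≠ d)
    (halign : ¬ PerfectlyAlign m p M P) {x : Space d} (hx : x ∈ M ∩ P) :
    ∃ V ∈ 𝓝 x, dimH (M ∩ P ∩ V) < m := by
  obtain ⟨S, T, hSM, hTP, htrans⟩ := exists_transversalAt hM hP halign hx
  obtain ⟨Φ, hxΦ, hΦ, hΦs, hΦM⟩ := hM.exists_chart_mem_slice hx.1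
  obtain ⟨Ψ, hxΨ, hΨ, hΨs, hΨP⟩ := hP.exists_chart_mem_slice hx.2
  have hΦn := Φ.open_source.mem_nhds hxΦ
  have hΨn := Ψ.open_source.mem_nhds hxΨ
  have hΦd : HasStrictFDerivAt Φ (fderiv ℝ Φ x) x :=
    (hΦ.contDiffAt hΦn).hasStrictFDerivAt (by simp)
  have hΨd : HasStrictFDerivAt Ψ (fderiv ℝ Ψ x) x :=
    (hΨ.contDiffAt hΨn).hasStrictFDerivAt (by simp)
  -- The coordinate of `Ψ` that vanishes on `P`, and its derivative.
  let j : Fin d := ⟨p, lt_of_le_of_ne hP.dim_le hp⟩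
  let A : Space d →L[ℝ] ℝ := (EuclideanSpace.proj j).comp (fderiv ℝ Ψ x)
  have hTA : tangentSpaceAt T x ≤ LinearMap.ker (A : Space d →ₗ[ℝ] ℝ) := by
    refine Submodule.span_le.2 ?_
    rintro v ⟨γ, hγ, h0, hγT, rfl⟩
    have hsrc : ∀ᶠ t in 𝓝 (0 : ℝ), γ t ∈ Ψ.source :=
      hγ.continuousAt.eventually (h0.symm ▸ hΨn)
    refine clm_apply_velocity_eq_zero hΨd.hasFDerivAt (hγ.differentiableAt (by simp)) h0
      (EuclideanSpace.proj j) ?_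
    filter_upwards [hsrc, hγT] with t h1 h2
    exact hΨP _ h1 (hTP h2) j le_rfl
  have hA : ∃ u, A u ≠ 0 := by
    obtain ⟨u, hu⟩ := LinearMap.injective_iff_surjective
      (f := (fderiv ℝ Ψ x : Space d →ₗ[ℝ] Space d)).1 (injective_fderiv_chart hxΨ hΨ hΨs)
      (EuclideanSpace.single j 1)
    refine ⟨u, ?_⟩
    have hu' : fderiv ℝ Ψ x u = EuclideanSpace.single j 1 := hu
    simp [A, hu']
  have hSA : ¬ tangentSpaceAt S x ≤ LinearMap.ker (A : Space d →ₗ[ℝ] ℝ) := by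
    intro hcon
    have htop : (⊤ : Submodule ℝ (Space d)) ≤ LinearMap.ker (A : Space d →ₗ[ℝ] ℝ) :=
      htrans ▸ sup_le hcon hTA
    obtain ⟨u, hu⟩ := hA
    exact hu (htop (Submodule.mem_top (x := u)))
  obtain ⟨v, ⟨γ, hγ, h0, hγS, hγv⟩, hv⟩ := not_subset.1 (mt Submodule.span_le.2 hSA)
  have hAv : A v ≠ 0 := hv
  have hw : fderiv ℝ Φ x v ∈ sliceSubmodule d m := by
    intro i hi
    have hsrc : ∀ᶠ t in 𝓝 (0 : ℝ), γ t ∈ Φ.source :=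
      hγ.continuousAt.eventually (h0.symm ▸ hΦn)
    rw [← hγv]
    refine clm_apply_velocity_eq_zero hΦd.hasFDerivAt (hγ.differentiableAt (by simp)) h0
      (EuclideanSpace.proj i) ?_
    filter_upwards [hsrc, hγS] with t h1 h2
    exact hΦM _ h1 (hSM h2) i hi
  have hΦinj := injective_fderiv_chart hxΦ hΦ hΦs
  set w := fderiv ℝ Φ x v with hwdef
  have hw0 : w ≠ 0 := fun h => hAv (by
    rw [hΦinj (a₁ := v) (a₂ := 0) (by rw [← hwdef, h, map_zero]), map_zero])
  obtain ⟨ℓ, hℓ⟩ := SeparatingDual.exists_eq_one (R := ℝ) hw0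
  -- The projection along `w` onto `ker ℓ`.
  let π : Space d →L[ℝ] Space d := ContinuousLinearMap.id ℝ (Space d) - ℓ.smulRight w
  have hF : HasStrictFDerivAt (fun y => (π (Φ y), EuclideanSpace.proj (𝕜 := ℝ) j (Ψ y)))
      ((π.comp (fderiv ℝ Φ x)).prod A) x :=
    (π.hasStrictFDerivAt.comp x hΦd).prodMk
      ((EuclideanSpace.proj (𝕜 := ℝ) j).hasStrictFDerivAt.comp x hΨd)
  have hFinj : Function.Injective ((π.comp (fderiv ℝ Φ x)).prod A) := by
    refine (injective_iff_map_eq_zero _).2 fun u hu => ?_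
    have h1 : fderiv ℝ Φ x u - ℓ (fderiv ℝ Φ x u) • w = 0 := congrArg Prod.fst hu
    have h2 : A u = 0 := congrArg Prod.snd hu
    have h3 : u = ℓ (fderiv ℝ Φ x u) • v := hΦinj (by rw [map_smul]; exact sub_eq_zero.1 h1)
    rw [h3, map_smul, smul_eq_mul, mul_eq_zero] at h2
    rw [h3, h2.resolve_right hAv, zero_smul]
  obtain ⟨V, hV, hdim⟩ := exists_nhds_dimH_le hF hFinj
  let N : Submodule ℝ (Space d) := sliceSubmodule d m ⊓ LinearMap.ker (ℓ : Space d →ₗ[ℝ] ℝ)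
  let L : Submodule ℝ (Space d × ℝ) := N.map (LinearMap.inl ℝ (Space d) ℝ)
  have hL : Module.finrank ℝ L < m := by
    have hlt : N < sliceSubmodule d m := lt_of_le_of_ne inf_le_left fun h => by
      have h1 : ℓ w = 0 := (h.symm ▸ hw : w ∈ N).2
      exact one_ne_zero (hℓ.symm.trans h1)
    exact ((Submodule.finrank_map_le _ _).trans_lt
      (Submodule.finrank_lt_finrank_of_lt hlt)).trans_le (finrank_sliceSubmodule_le hM.dim_le)
  refine ⟨V ∩ (Φ.source ∩ Ψ.source), Filter.inter_mem hV (Filter.inter_mem hΦn hΨn), ?_⟩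
  have hle := hdim (M ∩ P ∩ (Φ.source ∩ Ψ.source)) L ?_
  · rw [dimH_submodule] at hle
    rw [inter_comm V, ← inter_assoc]
    exact hle.trans_lt (by exact_mod_cast hL)
  · rintro y ⟨⟨⟨hyM, hyP⟩, hyΦ, hyΨ⟩, -⟩
    have hy : Φ y ∈ sliceSubmodule d m := hΦM y hyΦ hyM
    refine ⟨π (Φ y), ⟨?_, ?_⟩, Prod.ext rfl (hΨP y hyΨ hyP j le_rfl).symm⟩
    · exact (sliceSubmodule d m).sub_mem hy ((sliceSubmodule d m).smul_mem _ hw)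
    · change ℓ (Φ y - ℓ (Φ y) • w) = 0
      simp [hℓ]

theorem hausdorffMeasure_inter_eq_zero {d m p : ℕ} {M P : Set (Space d)}
    (hM : IsRegularSubmanifold m M) (hP : IsRegularSubmanifold p P) (hp : p ≠ d)
    (halign : ¬ PerfectlyAlign m p M P) :
    Measure.hausdorffMeasure (m : ℝ) (M ∩ P) = 0 := by
  refine measure_null_of_locally_null _ fun x hx => ?_
  obtain ⟨V, hV, hdim⟩ := exists_nhds_dimH_inter_lt hM hP hp halign hx
  exact ⟨M ∩ P ∩ V, inter_mem_nhdsWithin _ hV,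
    by simpa using hausdorffMeasure_of_dimH_lt (d := (m : NNReal)) (by simpa using hdim)⟩

theorem PerfectlyAlign.symm {d m p : ℕ} {M P : Set (Space d)} (h : PerfectlyAlign m p M P) :
    PerfectlyAlign p m P M := by
  have key : ∀ {S T : Set (Space d)},
      PerfectlyAlignBoundaryless S T → PerfectlyAlignBoundaryless T S := by
    rintro S T ⟨x, hx, h⟩
    exact ⟨x, hx.symm, fun h' => h (sup_comm _ _ |>.trans h')⟩
  rcases h with h | h | h | h
  · exact Or.inl (key h)
  · exact Or.inr (Or.inr (Or.inl (key h)))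
  · exact Or.inr (Or.inl (key h))
  · exact Or.inr (Or.inr (Or.inr (key h)))

/-! ### The discriminator -/

theorem negLog_one : negLog 1 = 0 := by simp [negLog]

/-- A discriminator of accuracy one attains the trivial upper bound `0` of the objective. -/
theorem HasAccuracyOne.isOptimalDiscriminator {d : ℕ} {Pr Pg : Measure (Space d)}
    [IsProbabilityMeasure Pr] [IsProbabilityMeasure Pg] {D : Space d → ℝ}
    (h : HasAccuracyOne Pr Pg D) (hD : IsDiscriminator D) : IsOptimalDiscriminator Pr Pg D := by
  refine ⟨hD, fun D' _ => ?_⟩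
  have hr : ∀ᵐ x ∂Pr, D x = 1 :=
    (mem_ae_iff_prob_eq_one (hD.1 (measurableSet_singleton 1))).2 h.1
  have hg : ∀ᵐ x ∂Pg, D x = 0 :=
    (mem_ae_iff_prob_eq_one (hD.1 (measurableSet_singleton 0))).2 h.2
  have h1 : ∫⁻ x, negLog (D x) ∂Pr = 0 := by
    rw [lintegral_congr_ae (g := fun _ => 0), lintegral_zero]
    filter_upwards [hr] with x hx
    rw [hx, negLog_one]
  have h2 : ∫⁻ x, negLog (1 - D x) ∂Pg = 0 := by
    rw [lintegral_congr_ae (g := fun _ => 0), lintegral_zero]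
    filter_upwards [hg] with x hx
    rw [hx, sub_zero, negLog_one]
  have hneg : ∀ a : ℝ≥0∞, -(a : EReal) ≤ 0 := fun a =>
    EReal.neg_le_zero.2 (EReal.coe_ennreal_nonneg a)
  simp only [ganObjective, h1, h2]
  simpa using add_le_add (hneg _) (hneg _)

theorem smoothNearWithZeroGradient_of_eventually_eq {d : ℕ} {D : Space d → ℝ} {x : Space d}
    {c : ℝ} (h : ∀ᶠ y in 𝓝 x, D y = c) : SmoothNearWithZeroGradient D x := by
  refine ⟨?_, (hasGradientAt_const x c).congr_of_eventuallyEq h⟩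
  obtain ⟨U, hU, hUo, hxU⟩ := eventually_nhds_iff.1 h
  exact ⟨U, hUo, hxU, contDiffOn_const.congr hU⟩

/-- The indicator of the set of points closer to `M` than to `P`. The extended distance makes an
empty set infinitely far away. -/
noncomputable def closerIndicator {d : ℕ} (M P : Set (Space d)) : Space d → ℝ :=
  {x | Metric.infEDist x M < Metric.infEDist x P}.indicator 1

theorem isDiscriminator_closerIndicator {d : ℕ} (M P : Set (Space d)) :
    IsDiscriminator (closerIndicator M P) := by
  refine ⟨measurable_one.indicator (measurableSet_lt measurable_infEDist measurable_infEDist),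
    fun x => ?_⟩
  unfold closerIndicator indicator
  split_ifs <;> simp

theorem eventually_closerIndicator_eq_one {d : ℕ} {M P : Set (Space d)} (hP : IsClosed P)
    {x : Space d} (hx : x ∈ M \ P) : ∀ᶠ y in 𝓝 x, closerIndicator M P y = 1 := by
  have hlt : Metric.infEDist x M < Metric.infEDist x P := by
    rw [Metric.infEDist_zero_of_mem hx.1, pos_iff_ne_zero, Ne,
      ← Metric.mem_iff_infEDist_zero_of_closed hP]
    exact hx.2
  filter_upwards [Metric.continuous_infEDist.continuousAt.eventually_lt
    Metric.continuous_infEDist.continuousAt hlt] with y hy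
  simp [closerIndicator, hy]

theorem eventually_closerIndicator_eq_zero {d : ℕ} {M P : Set (Space d)} (hM : IsClosed M)
    {x : Space d} (hx : x ∈ P \ M) : ∀ᶠ y in 𝓝 x, closerIndicator M P y = 0 := by
  have hlt : Metric.infEDist x P < Metric.infEDist x M := by
    rw [Metric.infEDist_zero_of_mem hx.1, pos_iff_ne_zero, Ne,
      ← Metric.mem_iff_infEDist_zero_of_closed hM]
    exact hx.2
  filter_upwards [Metric.continuous_infEDist.continuousAt.eventually_lt
    Metric.continuous_infEDist.continuousAt hlt] with y hy
  simp [closerIndicator, le_of_lt hy]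

theorem ae_manifoldMeasure_mem_diff {d m : ℕ} {M P : Set (Space d)} (hM : IsClosed M)
    (h : Measure.hausdorffMeasure (m : ℝ) (M ∩ P) = 0) :
    ∀ᵐ x ∂(manifoldMeasure m M), x ∈ M \ P := by
  refine (ae_restrict_iff' hM.measurableSet).2 ?_
  filter_upwards [measure_eq_zero_iff_ae_notMem.1 h] with x hx hxM
  exact ⟨hxM, fun hxP => hx ⟨hxM, hxP⟩⟩

end GANPerfect

theorem mainTheorem1 {d m p : ℕ} (M P : Set (GANPerfect.Space d))
    (hM : GANPerfect.IsRegularSubmanifold m M) (hP : GANPerfect.IsRegularSubmanifold p P)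
    (hMclosed : IsClosed M) (hPclosed : IsClosed P)
    (hm : m ≠ d) (hp : p ≠ d)
    (halign : ¬ GANPerfect.PerfectlyAlign m p M P)
    (Pr Pg : Measure (GANPerfect.Space d)) [IsProbabilityMeasure Pr] [IsProbabilityMeasure Pg]
    (hPr : Pr.support ⊆ M) (hPg : Pg.support ⊆ P)
    (hPrac : ∀ A : Set (GANPerfect.Space d), GANPerfect.manifoldMeasure m M A = 0 → Pr A = 0)
    (hPgac : ∀ A : Set (GANPerfect.Space d), GANPerfect.manifoldMeasure p P A = 0 → Pg A = 0) :
    ∃ D : GANPerfect.Space d → ℝ,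
      GANPerfect.IsOptimalDiscriminator Pr Pg D ∧
      GANPerfect.HasAccuracyOne Pr Pg D ∧
      (∀ᵐ x ∂(GANPerfect.manifoldMeasure m M), GANPerfect.SmoothNearWithZeroGradient D x) ∧
      (∀ᵐ x ∂(GANPerfect.manifoldMeasure p P), GANPerfect.SmoothNearWithZeroGradient D x) := by
  open GANPerfect in
  have hMae := ae_manifoldMeasure_mem_diff hMclosed
    (hausdorffMeasure_inter_eq_zero hM hP hp halign)
  have hPae := ae_manifoldMeasure_mem_diff hPclosed
    (hausdorffMeasure_inter_eq_zero hP hM hm fun h => halign h.symm)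
  have hdisc := isDiscriminator_closerIndicator M P
  -- The exceptional sets are null for the volumes, hence for `Pr` and `Pg`.
  have hacc : HasAccuracyOne Pr Pg (closerIndicator M P) := by
    constructor
    · refine (mem_ae_iff_prob_eq_one (hdisc.1 (measurableSet_singleton 1))).1 ?_
      filter_upwards [show ∀ᵐ x ∂Pr, x ∈ M \ P from hPrac _ hMae] with x hx
      exact (eventually_closerIndicator_eq_one hPclosed hx).self_of_nhds
    · refine (mem_ae_iff_prob_eq_one (hdisc.1 (measurableSet_singleton 0))).1 ?_
      filter_upwards [show ∀ᵐ x ∂Pg, x ∈ P \ M from hPgac _ hPae] with x hx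
      exact (eventually_closerIndicator_eq_zero hMclosed hx).self_of_nhds
  refine ⟨closerIndicator M P, hacc.isOptimalDiscriminator hdisc, hacc, ?_, ?_⟩
  · filter_upwards [hMae] with x hx
    exact smoothNearWithZeroGradient_of_eventually_eq
      (eventually_closerIndicator_eq_one hPclosed hx)
  · filter_upwards [hPae] with x hx
    exact smoothNearWithZeroGradient_of_eventually_eq
      (eventually_closerIndicator_eq_zero hMclosed hx)
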